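/- Write $\operatorname{dom} f=\{x\in\mathbb{R}^d: f(x)<+\infty\}$, and let $\Gamma_0(\mathbb{R}^d)$ be the class of lower semicontinuous convex functions $f\colon\mathbb{R}^d\to\mathbb{R}\cup\{+\infty\}$ with nonempty domain. Let $g,\psi\in\Gamma_0(\mathbb{R}^d)$ and $\mathcal{Y}=\operatorname{int}\operatorname{dom}\psi$. Assume the following. 1. $g$ is bounded below, and either $e^{-g}$ is Lebesgue integrable on $\mathbb{R}^d$ or $g$ is real-valued and Lipschitz on $\mathbb{R}^d$. 2. $\psi$ is Legendre, i.e. $\mathcal{Y}\neq\varnothing$, $\psi$ is differentiable and strictly convex on $\mathcal{Y}$, and $\|\nabla\psi(x_n)\|\to+\infty$ for every sequence $(x_n)$ in $\mathcal{Y}$ that converges to a boundary point of $\operatorname{dom}\psi$. Moreover $\psi$ is of class $\mathscr{C}^3$ on $\mathcal{Y}$ and supercoercive, i.e. $\psi(x)/\|x\|\to+\infty$ as $\|x\|\to+\infty$. 3. $\operatorname{dom} g\cap\mathcal{Y}\neq\varnothing$. 4. The Bregman divergence $D_\psi\colon\mathbb{R}^d\times\mathbb{R}^d\to[0,+\infty]$,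 given by $D_\psi(x,y)=\psi(x)-\psi(y)-\langle\nabla\psi(y),x-y\rangle$ if $y\in\mathcal{Y}$ and $D_\psi(x,y)=+\infty$ otherwise, is jointly convex, i.e. convex on $\mathbb{R}^d\times\mathbb{R}^d$. For every $y\in\mathcal{Y}$ the function $D_\psi(y,\cdot)$ is strictly convex and continuous on $\mathcal{Y}$, and $D_\psi(y,z)\to+\infty$ as $\|z\|\to+\infty$. For $\lambda>0$ define the left and right Bregman–Moreau envelopes and proximity operators of $g$ by $$\overleftarrow{\mathrm{env}}_\lambda(x)=\inf_{y\in\mathbb{R}^d}\Big\{g(y)+\tfrac1\lambda D_\psi(y,x)\Big\},\qquad \overrightarrow{\mathrm{env}}_\lambda(x)=\inf_{y\in\mathbb{R}^d}\Big\{g(y)+\tfrac1\lambda D_\psi(x,y)\Big\},$$ $$\overleftarrow{\mathrm{P}}_\lambda(x)=\operatorname*{argmin}_{y\in\mathbb{R}^d}\Big\{g(y)+\tfrac1\lambda D_\psi(y,x)\Big\},\qquad \overrightarrow{\mathrm{P}}_\lambda(x)=\operatorname*{argmin}_{y\in\mathbb{R}^d}\Big\{g(y)+\tfrac1\lambda D_\psi(x,y)\Big\}.$$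 Then the following hold. (a) For every $\lambda>0$ and $y\in\mathcal{Y}$, both envelopes are finite at $y$, both minimizers $\overleftarrow{\mathrm{P}}_\lambda(y)$ and $\overrightarrow{\mathrm{P}}_\lambda(y)$ exist, are unique and lie in $\mathcal{Y}$, both envelopes are differentiable at $y$, and $$\nabla\overleftarrow{\mathrm{env}}_\lambda(y)=\frac1\lambda\nabla^2\psi(y)\big(y-\overleftarrow{\mathrm{P}}_\lambda(y)\big),\qquad \nabla\overrightarrow{\mathrm{env}}_\lambda(y)=\frac1\lambda\Big(\nabla\psi(y)-\nabla\psi\big(\overrightarrow{\mathrm{P}}_\lambda(y)\big)\Big).$$ (b) If $D_\psi(y,\cdot)$ is continuous and convex on $\mathcal{Y}$ for every $y\in\mathcal{Y}$, and $\nabla\psi$ is Lipschitz on $\mathcal{Y}$, then for every $\lambda>0$ both $\nabla\overleftarrow{\mathrm{env}}_\lambda$ and $\nabla\overrightarrow{\mathrm{env}}_\lambda$ are Lipschitz on $\mathcal{Y}$. (c) For every $y\in\mathcal{Y}$, both $\overleftarrow{\mathrm{env}}_\lambda(y)$ and $\overrightarrow{\mathrm{env}}_\lambda(y)$ are nonincreasing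 in $\lambda>0$ and converge to $g(y)\in\mathbb{R}\cup\{+\infty\}$ as $\lambda\downarrow0$. -/

import Mathlib

open Set Filter Topology MeasureTheory
open scoped NNReal ENNReal

namespace BregmanMoreau

noncomputable section

/-- Convexity of an extended-real-valued function: its epigraph is convex. -/
def EConvex {V : Type*} [AddCommGroup V] [Module ℝ V] (f : V → EReal) : Prop :=
  Convex ℝ {p : V × ℝ | f p.1 ≤ (p.2 : EReal)}

/-- The domain `{x | f x < +∞}`. -/
def dom {V : Type*} (f : V → EReal) : Set V := {x | f x < ⊤}

/-- The real-valued function that agrees with `f` wherever `f` is finite; it is only used on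
sets where `f` is finite. -/
def finPart {V : Type*} (f : V → EReal) : V → ℝ := fun x => (f x).toReal

section

variable {E : Type*} [NormedAddCommGroup E] [InnerProductSpace ℝ E] [CompleteSpace E]

/-- The class `Γ₀`: lower semicontinuous convex functions with values in `ℝ ∪ {+∞}` and
nonempty domain. -/
structure IsGammaZero (f : E → EReal) : Prop where
  ne_bot : ∀ x, f x ≠ ⊥
  dom_nonempty : (dom f).Nonempty
  lsc : LowerSemicontinuous f
  convex : EConvex f

/-- The interior of the domain. -/
def intDom (f : E → EReal) : Set E := interior (dom f)

/-- The gradient of `f` (meaningful at points of `intDom f`). -/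
def grad (f : E → EReal) : E → E := fun x => gradient (finPart f) x

/-- The Hessian of `f`, as the derivative of its gradient (meaningful on `intDom f`). -/
def hess (f : E → EReal) (x : E) : E →L[ℝ] E := fderiv ℝ (grad f) x

/-- Essential smoothness: `f` is differentiable on the nonempty interior of its domain and the norm
of the gradient tends to `+∞` at every boundary point of the domain. -/
structure EssentiallySmooth (f : E → EReal) : Prop where
  nonempty : (intDom f).Nonempty
  differentiableAt : ∀ x ∈ intDom f, DifferentiableAt ℝ (finPart f) x
  blowup : ∀ x ∈ frontier (dom f), Tendsto (fun z => ‖grad f z‖) (𝓝[intDom f] x) atTop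

/-- Legendre functions: essentially smooth, and strictly convex on the interior of the domain. -/
structure IsLegendre (f : E → EReal) : Prop where
  essentiallySmooth : EssentiallySmooth f
  strictConvexOn : StrictConvexOn ℝ (intDom f) (finPart f)

/-- `f x / ‖x‖ → +∞` as `‖x‖ → +∞`. -/
def Supercoercive (f : E → EReal) : Prop :=
  Tendsto (fun x => f x / ((‖x‖ : ℝ) : EReal)) (Bornology.cobounded E) (𝓝 ⊤)

/-- `f x → +∞` as `‖x‖ → +∞`. -/
def Coercive (f : E → EReal) : Prop :=
  Tendsto f (Bornology.cobounded E) (𝓝 ⊤)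

open Classical in
/-- The Bregman divergence `D_ψ(x, y)`. -/
def bregman (ψ : E → EReal) (x y : E) : EReal :=
  if y ∈ intDom ψ then ψ x - ψ y - ((inner ℝ (grad ψ y) (x - y) : ℝ) : EReal) else ⊤

/-- The function `y ↦ g y + (1/lam) D_ψ(y, x)`. -/
def leftObj (lam : ℝ) (g ψ : E → EReal) (x : E) : E → EReal :=
  fun y => g y + ((1 / lam : ℝ) : EReal) * bregman ψ y x

/-- The function `y ↦ g y + (1/lam) D_ψ(x, y)`. -/
def rightObj (lam : ℝ) (g ψ : E → EReal) (x : E) : E → EReal :=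
  fun y => g y + ((1 / lam : ℝ) : EReal) * bregman ψ x y

/-- The left Bregman–Moreau envelope. -/
def leftEnv (lam : ℝ) (g ψ : E → EReal) (x : E) : EReal := ⨅ y, leftObj lam g ψ x y

/-- The right Bregman–Moreau envelope. -/
def rightEnv (lam : ℝ) (g ψ : E → EReal) (x : E) : EReal := ⨅ y, rightObj lam g ψ x y

/-- The left Bregman proximity operator, as the set of minimizers. -/
def leftProx (lam : ℝ) (g ψ : E → EReal) (x : E) : Set E :=
  {p | ∀ y, leftObj lam g ψ x p ≤ leftObj lam g ψ x y}

/-- The right Bregman proximity operator, as the set of minimizers. -/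
def rightProx (lam : ℝ) (g ψ : E → EReal) (x : E) : Set E :=
  {p | ∀ y, rightObj lam g ψ x p ≤ rightObj lam g ψ x y}

/-- `g` is real-valued and Lipschitz on the whole space. -/
def IsLipschitz (g : E → EReal) : Prop :=
  (∀ x, g x ≠ ⊥ ∧ g x ≠ ⊤) ∧ ∃ K : ℝ≥0, LipschitzWith K (finPart g)

end

/-- `exp (-g)` is integrable with respect to the Lebesgue measure (for Borel measurable `g`, in
particular for lower semicontinuous `g`, as `exp (-g) ≥ 0`). -/
def ExpNegIntegrable {d : ℕ} (g : EuclideanSpace ℝ (Fin d) → EReal) : Prop :=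
  ∫⁻ x, EReal.exp (-g x) < ⊤

end

end BregmanMoreau

open BregmanMoreau

/-!
The left and the right objective are both of the form `g + (1 / lam) K` with a kernel `K`, equal
to `D_ψ(·, x)` or `D_ψ(x, ·)`, which is nonnegative, lower semicontinuous and coercive; `g` is
bounded below, so minimizers exist (`exists_minimizer`), and strict convexity of `K` on the
interior of `dom ψ` makes them unique there (`minimizer_unique`). The boundary is handled by one
estimate, `exists_mul_norm_grad_le`: for an interior point `x`, the divergence `D_ψ(x, y)` dominates
a positive multiple of `‖∇ψ(y)‖`, which blows up as `y` approaches the boundary. It gives lower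
semicontinuity of `D_ψ(x, ·)`, and it keeps left proximal points in the interior
(`mem_intDom_of_minimizer`).

Joint convexity makes the envelopes convex, and at each `y` the envelope is touched from above by
the smooth function obtained by freezing the proximal point. A convex function touched from above
by a differentiable one is differentiable with the same derivative
(`hasFDerivAt_of_convexOn_of_le`), which gives the two gradient formulas without any continuity of
the proximity operators.

If `∇ψ` is Lipschitz, it cannot blow up, so `ψ` is finite everywhere. The affine minorant of the
jointly convex `D_ψ` at `(x, y)` is then nonpositive along the whole diagonal, so it is constant
there, which says `∇ψ(x) - ∇ψ(y) = ∇²ψ(y)(x - y)` (`grad_sub_grad_eq_hess`). Hence `D_ψ` is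
symmetric, the two envelopes coincide, and the right envelope has quadratic upper models, which for
a convex function forces a Lipschitz gradient (`norm_grad_sub_le`).

For the limit, a convex kernel vanishing at `y` and positive elsewhere near `y` is bounded away
from zero off each ball around `y` (`exists_pos_le_of_dist`), so that for small `lam` only points
near `y` matter, and there `g` is almost at least `g y`.
-/

namespace BregmanMoreau

/-! ### Extended-real-valued convex functions -/

theorem coe_finPart {V : Type*} {f : V → EReal} {x : V} (h : f x ≠ ⊥) (hx : x ∈ dom f) :
    ((finPart f x : ℝ) : EReal) = f x :=
  EReal.coe_toReal (ne_of_lt hx) h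

section Convexity

variable {V W : Type*} [AddCommGroup V] [Module ℝ V] [AddCommGroup W] [Module ℝ W]

theorem EConvex.le_combo {f : V → EReal} (hf : EConvex f) {x y : V} {a b s t : ℝ}
    (hx : f x ≤ a) (hy : f y ≤ b) (hs : 0 ≤ s) (ht : 0 ≤ t) (hst : s + t = 1) :
    f (s • x + t • y) ≤ ((s * a + t * b : ℝ) : EReal) :=
  hf (x := (x, a)) hx (y := (y, b)) hy hs ht hst

theorem EConvex.of_le_combo {f : V → EReal}
    (h : ∀ (x y : V) (a b s t : ℝ), f x ≤ a → f y ≤ b → 0 ≤ s → 0 ≤ t → s + t = 1 →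
      f (s • x + t • y) ≤ ((s * a + t * b : ℝ) : EReal)) : EConvex f := by
  rintro ⟨x, a⟩ hx ⟨y, b⟩ hy s t hs ht hst
  exact h x y a b s t hx hy hs ht hst

theorem exists_real_of_add_le {u v : EReal} {r : ℝ} (hu : u ≠ ⊥) (hv : v ≠ ⊥) (h : u + v ≤ r) :
    ∃ a b : ℝ, u = a ∧ v = b ∧ a + b ≤ r := by
  induction u with
  | bot => exact absurd rfl hu
  | top => rw [EReal.top_add_of_ne_bot hv] at h; simp at h
  | coe a =>
    induction v with
    | bot => exact absurd rfl hv
    | top => simp at h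
    | coe b => exact ⟨a, b, rfl, rfl, by exact_mod_cast h⟩

theorem EConvex.add {f h : V → EReal} (hf : EConvex f) (hh : EConvex h)
    (hf' : ∀ x, f x ≠ ⊥) (hh' : ∀ x, h x ≠ ⊥) : EConvex fun x => f x + h x := by
  refine EConvex.of_le_combo fun x y a b s t hx hy hs ht hst => ?_
  obtain ⟨a₁, a₂, h₁, h₂, ha⟩ := exists_real_of_add_le (hf' x) (hh' x) hx
  obtain ⟨b₁, b₂, h₃, h₄, hb⟩ := exists_real_of_add_le (hf' y) (hh' y) hy
  refine (add_le_add (hf.le_combo h₁.le h₃.le hs ht hst)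
    (hh.le_combo h₂.le h₄.le hs ht hst)).trans ?_
  rw [← EReal.coe_add, EReal.coe_le_coe_iff]
  nlinarith [mul_le_mul_of_nonneg_left ha hs, mul_le_mul_of_nonneg_left hb ht]

theorem EConvex.const_mul {f : V → EReal} (hf : EConvex f) (hf' : ∀ x, f x ≠ ⊥) {c : ℝ}
    (hc : 0 < c) : EConvex fun x => (c : EReal) * f x := by
  have key : ∀ x (a : ℝ), (c : EReal) * f x ≤ a → f x ≤ ((a / c : ℝ) : EReal) := by
    intro x a h
    have hx := hf' x
    generalize f x = u at *
    induction u with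
    | bot => exact absurd rfl hx
    | top => rw [EReal.coe_mul_top_of_pos hc] at h; simp at h
    | coe u =>
      rw [← EReal.coe_mul, EReal.coe_le_coe_iff] at h
      rw [EReal.coe_le_coe_iff, le_div_iff₀ hc]
      linarith
  refine EConvex.of_le_combo fun x y a b s t hx hy hs ht hst => ?_
  refine (mul_le_mul_of_nonneg_left (hf.le_combo (key x a hx) (key y b hy) hs ht hst)
    (by exact_mod_cast hc.le)).trans ?_
  rw [← EReal.coe_mul, EReal.coe_le_coe_iff]
  apply le_of_eq
  field_simp

theorem EConvex.comp_linearMap {f : W → EReal} (hf : EConvex f) (A : V →ₗ[ℝ] W) :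
    EConvex fun x => f (A x) := by
  refine EConvex.of_le_combo fun x y a b s t hx hy hs ht hst => ?_
  simpa using hf.le_combo hx hy hs ht hst

theorem EConvex.slice_left {f : V × W → EReal} (hf : EConvex f) (y : W) :
    EConvex fun x => f (x, y) := by
  refine EConvex.of_le_combo fun x x' a b s t hx hy hs ht hst => ?_
  simpa [← add_smul, hst] using hf.le_combo hx hy hs ht hst

theorem EConvex.convex_dom {f : V → EReal} (hf : EConvex f) : Convex ℝ (dom f) := by
  intro x hx y hy s t hs ht hst
  obtain ⟨a, ha, -⟩ := EReal.lt_iff_exists_real_btwn.1 hx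
  obtain ⟨b, hb, -⟩ := EReal.lt_iff_exists_real_btwn.1 hy
  exact (hf.le_combo ha.le hb.le hs ht hst).trans_lt (EReal.coe_lt_top _)

theorem EConvex.convexOn_finPart {f : V → EReal} (hf : EConvex f) {S : Set V}
    (hS : Convex ℝ S) (hdom : S ⊆ dom f) (hbot : ∀ x ∈ S, f x ≠ ⊥) :
    ConvexOn ℝ S (finPart f) := by
  refine ⟨hS, fun x hx y hy s t hs ht hst => ?_⟩
  have hz := hS hx hy hs ht hst
  have h := hf.le_combo (coe_finPart (hbot x hx) (hdom hx)).ge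
    (coe_finPart (hbot y hy) (hdom hy)).ge hs ht hst
  rw [← coe_finPart (hbot _ hz) (hdom hz), EReal.coe_le_coe_iff] at h
  exact h

/-- Partial minimization preserves convexity. -/
theorem EConvex.convexOn_iInf {Φ : V → W → EReal} (hΦ : EConvex fun q : V × W => Φ q.1 q.2)
    {Y : Set W} (hY : Convex ℝ Y)
    (hmin : ∀ x ∈ Y, ∃ p, (∀ q, Φ p x ≤ Φ q x) ∧ Φ p x ≠ ⊥ ∧ Φ p x ≠ ⊤) :
    ConvexOn ℝ Y (finPart fun x => ⨅ q, Φ q x) := by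
  have hval : ∀ x ∈ Y, ∃ p, ((finPart (fun x => ⨅ q, Φ q x) x : ℝ) : EReal) = Φ p x ∧
      ∀ q, Φ p x ≤ Φ q x := by
    intro x hx
    obtain ⟨p, hp, hb, ht⟩ := hmin x hx
    have : (⨅ q, Φ q x) = Φ p x := le_antisymm (iInf_le _ p) (le_iInf hp)
    exact ⟨p, by rw [finPart, this, EReal.coe_toReal ht hb], hp⟩
  refine ⟨hY, fun x hx y hy s t hs ht hst => ?_⟩
  obtain ⟨p, hp, -⟩ := hval x hx
  obtain ⟨q, hq, -⟩ := hval y hy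
  obtain ⟨r, hr, hr'⟩ := hval _ (hY hx hy hs ht hst)
  have h := hΦ.le_combo (x := (p, x)) (y := (q, y)) hp.ge hq.ge hs ht hst
  have h' := hr.le.trans ((hr' (s • p + t • q)).trans h)
  exact_mod_cast h'

end Convexity

/-! ### Differentiability of convex functions -/

section Differentiability

variable {F : Type*} [NormedAddCommGroup F] [NormedSpace ℝ F]

theorem convexOn_add_fderiv_le {f : F → ℝ} {S : Set F} {x y : F} {f' : F →L[ℝ] ℝ}
    (hf : ConvexOn ℝ S f) (hx : x ∈ S) (hy : y ∈ S) (h : HasFDerivAt f f' y) :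
    f y + f' (x - y) ≤ f x := by
  have hl : HasDerivAt (fun t : ℝ => y + t • (x - y)) (x - y) 0 := by
    simpa using ((hasDerivAt_id (0 : ℝ)).smul_const (x - y)).const_add y
  have hd : HasDerivAt (fun t : ℝ => f (y + t • (x - y))) (f' (x - y)) 0 :=
    HasFDerivAt.comp_hasDerivAt (0 : ℝ) (by simpa using h) hl
  have hs := hd.tendsto_slope_zero_right
  have hle : ∀ᶠ t : ℝ in 𝓝[>] 0,
      t⁻¹ • (f (y + (0 + t) • (x - y)) - f (y + (0 : ℝ) • (x - y))) ≤ f x - f y := by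
    filter_upwards [Ioo_mem_nhdsGT (zero_lt_one' ℝ)] with t ht
    have h1 := hf.2 hy hx (sub_nonneg.2 ht.2.le) ht.1.le (by ring)
    have h2 : (1 - t) • y + t • x = y + t • (x - y) := by module
    rw [h2] at h1
    simp only [smul_eq_mul, zero_add, zero_smul, add_zero] at h1 ⊢
    rw [inv_mul_le_iff₀ ht.1]
    linarith
  have := le_of_tendsto hs hle
  linarith

/-- A convex function that is touched from above at `y` by a function differentiable at `y` is
itself differentiable at `y`, with the same derivative: convexity gives
`f (y + v) - f y ≥ f y - f (y - v)`, so the touching function also bounds `f` from below. -/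
theorem hasFDerivAt_of_convexOn_of_le {f h : F → ℝ} {Y : Set F} {y : F} {h' : F →L[ℝ] ℝ}
    (hf : ConvexOn ℝ Y f) (hY : Y ∈ 𝓝 y) (hle : ∀ᶠ x in 𝓝 y, f x ≤ h x) (heq : f y = h y)
    (hh : HasFDerivAt h h' y) : HasFDerivAt f h' y := by
  rw [hasFDerivAt_iff_isLittleO_nhds_zero] at hh ⊢
  rw [Asymptotics.isLittleO_iff] at hh ⊢
  intro c hc
  have hadd : Tendsto (fun v : F => y + v) (𝓝 0) (𝓝 y) := by
    simpa using (show Continuous fun v : F => y + v by fun_prop).tendsto 0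
  have hneg : Tendsto (fun v : F => -v) (𝓝 0) (𝓝 0) := by
    simpa using (show Continuous fun v : F => -v by fun_prop).tendsto 0
  filter_upwards [hh hc, hneg.eventually (hh hc), hadd.eventually hle,
    (hadd.comp hneg).eventually hle, hadd.eventually hY, (hadd.comp hneg).eventually hY]
    with v h1 h2 h3 h4 h5 h6
  have hmid := hf.2 h5 h6 (by norm_num : (0 : ℝ) ≤ 1 / 2) (by norm_num : (0 : ℝ) ≤ 1 / 2)
    (by norm_num)
  have hy : (1 / 2 : ℝ) • (y + v) + (1 / 2 : ℝ) • ((fun v => y + v) ∘ fun v => -v) v = y := by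
    simp only [Function.comp]; module
  rw [hy] at hmid
  simp only [Function.comp, smul_eq_mul, map_neg, norm_neg, Real.norm_eq_abs, abs_le] at *
  constructor <;> linarith

/-- A convex function on the whole space lying below its quadratic upper models
`f y + f' y (x - y) + C ‖x - y‖²` has a Lipschitz gradient. -/
theorem norm_grad_sub_le {H : Type*} [NormedAddCommGroup H] [InnerProductSpace ℝ H]
    [CompleteSpace H] {f : H → ℝ} {G : H → H} {C : ℝ} (hf : ConvexOn ℝ univ f)
    (hG : ∀ x, HasGradientAt f (G x) x)
    (hC : ∀ x y, f x ≤ f y + inner ℝ (G y) (x - y) + C * ‖x - y‖ ^ 2) (x y : H) :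
    ‖G x - G y‖ ≤ 4 * C * ‖x - y‖ := by
  have hlow : ∀ x y, f y + inner ℝ (G y) (x - y) ≤ f x := fun x y => by
    simpa using convexOn_add_fderiv_le hf (mem_univ x) (mem_univ y) (hG y).hasFDerivAt
  rcases eq_or_ne x y with rfl | hxy
  · simp
  rcases eq_or_ne (G x) (G y) with hGe | hGe
  · -- the two models force `0 ≤ C`, which is needed as `C` is not assumed nonnegative
    have h1 := hlow x y
    have h2 := hC x y
    have h3 : 0 < ‖x - y‖ := norm_pos_iff.2 (sub_ne_zero.2 hxy)
    have h4 : 0 ≤ C := by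
      by_contra! hneg
      nlinarith [pow_pos h3 2]
    rw [hGe, sub_self, norm_zero]
    positivity
  have hd : 0 < ‖G x - G y‖ := norm_pos_iff.2 (sub_ne_zero.2 hGe)
  have hr : 0 < ‖x - y‖ := norm_pos_iff.2 (sub_ne_zero.2 hxy)
  -- compare the lower model at `x` with the upper model at `y`, at the point `y + w` where `w`
  -- has twice the length of `x - y` and the direction of `G x - G y`
  set w : H := (2 * ‖x - y‖ / ‖G x - G y‖) • (G x - G y) with hw
  have hwn : ‖w‖ = 2 * ‖x - y‖ := by
    rw [hw, norm_smul, Real.norm_of_nonneg (by positivity)]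
    field_simp
  have hwi : inner ℝ (G x - G y) w = 2 * ‖x - y‖ * ‖G x - G y‖ := by
    rw [hw, inner_smul_right, real_inner_self_eq_norm_sq]
    field_simp
  have h1 := hlow (y + w) x
  have h2 := hC (y + w) y
  have h3 := hlow x y
  have h4 := real_inner_le_norm (G x - G y) (x - y)
  have e1 : y + w - x = w - (x - y) := by abel
  have e2 : y + w - y = w := by abel
  rw [e1, inner_sub_right] at h1
  rw [e2, hwn] at h2
  rw [inner_sub_left] at hwi h4
  have h5 : ‖G x - G y‖ * ‖x - y‖ ≤ 4 * C * ‖x - y‖ * ‖x - y‖ := by nlinarith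
  exact le_of_mul_le_mul_right h5 hr

end Differentiability

section Bregman

variable {E : Type*} [NormedAddCommGroup E] {ψ : E → EReal}

/-! ### Elementary properties of the Bregman divergence -/

theorem intDom_subset_dom : intDom ψ ⊆ dom ψ := interior_subset

theorem intDom_mem_nhds {y : E} (hy : y ∈ intDom ψ) : intDom ψ ∈ 𝓝 y :=
  isOpen_interior.mem_nhds hy

theorem mem_frontier_dom {z : E} (hz : z ∉ intDom ψ) (hz' : (𝓝[intDom ψ] z).NeBot) :
    z ∈ frontier (dom ψ) :=
  ⟨closure_mono intDom_subset_dom (mem_closure_iff_nhdsWithin_neBot.2 hz'), hz⟩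

variable [InnerProductSpace ℝ E]

theorem IsGammaZero.convex_dom (hψ : IsGammaZero ψ) : Convex ℝ (dom ψ) := hψ.convex.convex_dom

theorem IsGammaZero.convex_intDom (hψ : IsGammaZero ψ) : Convex ℝ (intDom ψ) :=
  hψ.convex_dom.interior

theorem IsGammaZero.coe_finPart (hψ : IsGammaZero ψ) {x : E} (hx : x ∈ dom ψ) :
    ((finPart ψ x : ℝ) : EReal) = ψ x := BregmanMoreau.coe_finPart (hψ.ne_bot x) hx

theorem IsGammaZero.convexOn (hψ : IsGammaZero ψ) : ConvexOn ℝ (dom ψ) (finPart ψ) :=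
  hψ.convex.convexOn_finPart hψ.convex_dom Subset.rfl fun x _ => hψ.ne_bot x

variable [CompleteSpace E]

theorem EssentiallySmooth.hasGradientAt (hs : EssentiallySmooth ψ) {y : E} (hy : y ∈ intDom ψ) :
    HasGradientAt (finPart ψ) (grad ψ y) y := (hs.differentiableAt y hy).hasGradientAt

theorem add_inner_grad_le (hψ : IsGammaZero ψ) (hs : EssentiallySmooth ψ) {x y : E}
    (hx : x ∈ dom ψ) (hy : y ∈ intDom ψ) :
    finPart ψ y + inner ℝ (grad ψ y) (x - y) ≤ finPart ψ x := by
  simpa using convexOn_add_fderiv_le hψ.convexOn hx (intDom_subset_dom hy)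
    (hs.hasGradientAt hy).hasFDerivAt

/-- The Bregman divergence as a real number, at points where `ψ` is finite. -/
noncomputable def bregmanReal (ψ : E → EReal) (x y : E) : ℝ :=
  finPart ψ x - finPart ψ y - inner ℝ (grad ψ y) (x - y)

@[simp] theorem bregmanReal_self (x : E) : bregmanReal ψ x x = 0 := by simp [bregmanReal]

theorem bregmanReal_nonneg (hψ : IsGammaZero ψ) (hs : EssentiallySmooth ψ) {x y : E}
    (hx : x ∈ dom ψ) (hy : y ∈ intDom ψ) : 0 ≤ bregmanReal ψ x y := by
  have := add_inner_grad_le hψ hs hx hy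
  rw [bregmanReal]; linarith

theorem bregman_eq_sub (hψ : IsGammaZero ψ) {y : E} (hy : y ∈ intDom ψ) (x : E) :
    bregman ψ x y = ψ x + ((-finPart ψ y - inner ℝ (grad ψ y) (x - y) : ℝ) : EReal) := by
  rw [bregman, if_pos hy, ← hψ.coe_finPart (intDom_subset_dom hy), sub_eq_add_neg, sub_eq_add_neg,
    add_assoc, ← EReal.coe_neg, ← EReal.coe_neg, ← EReal.coe_add, ← sub_eq_add_neg]

theorem bregman_eq_coe (hψ : IsGammaZero ψ) {x y : E} (hx : x ∈ dom ψ) (hy : y ∈ intDom ψ) :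
    bregman ψ x y = (bregmanReal ψ x y : EReal) := by
  rw [bregman_eq_sub hψ hy, ← hψ.coe_finPart hx, ← EReal.coe_add, bregmanReal]
  congr 1; ring

theorem bregman_eq_top_of_notMem_intDom {x y : E} (hy : y ∉ intDom ψ) : bregman ψ x y = ⊤ :=
  if_neg hy

theorem bregman_eq_top_of_notMem_dom (hψ : IsGammaZero ψ) {x y : E} (hx : x ∉ dom ψ) :
    bregman ψ x y = ⊤ := by
  by_cases hy : y ∈ intDom ψ
  · have : ψ x = ⊤ := by simpa [dom] using hx
    rw [bregman_eq_sub hψ hy, this, EReal.top_add_coe]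
  · exact if_neg hy

theorem bregman_nonneg (hψ : IsGammaZero ψ) (hs : EssentiallySmooth ψ) (x y : E) :
    0 ≤ bregman ψ x y := by
  by_cases hy : y ∈ intDom ψ
  · by_cases hx : x ∈ dom ψ
    · rw [bregman_eq_coe hψ hx hy]
      exact_mod_cast bregmanReal_nonneg hψ hs hx hy
    · rw [bregman_eq_top_of_notMem_dom hψ hx]; exact le_top
  · rw [bregman_eq_top_of_notMem_intDom hy]; exact le_top

theorem ne_bot_of_nonneg {u : EReal} (h : 0 ≤ u) : u ≠ ⊥ :=
  (EReal.bot_lt_zero.trans_le h).ne'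

theorem bregman_ne_bot (hψ : IsGammaZero ψ) (hs : EssentiallySmooth ψ) (x y : E) :
    bregman ψ x y ≠ ⊥ := ne_bot_of_nonneg (bregman_nonneg hψ hs x y)

theorem finPart_bregman (hψ : IsGammaZero ψ) {x y : E} (hx : x ∈ dom ψ) (hy : y ∈ intDom ψ) :
    finPart (bregman ψ x) y = bregmanReal ψ x y := by
  rw [finPart, bregman_eq_coe hψ hx hy, EReal.toReal_coe]

theorem mem_dom_of_bregman_ne_top (hψ : IsGammaZero ψ) {x y : E} (h : bregman ψ x y ≠ ⊤) :
    x ∈ dom ψ := by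
  by_contra hx
  exact h (bregman_eq_top_of_notMem_dom hψ hx)

theorem mem_intDom_of_bregman_ne_top {x y : E} (h : bregman ψ x y ≠ ⊤) : y ∈ intDom ψ := by
  by_contra hy
  exact h (bregman_eq_top_of_notMem_intDom hy)

theorem strictConvexOn_bregmanReal (hl : IsLegendre ψ) (y : E) :
    StrictConvexOn ℝ (intDom ψ) fun x => bregmanReal ψ x y := by
  refine ⟨hl.strictConvexOn.1, fun x hx z hz hxz s t hs ht hst => ?_⟩
  have h := hl.strictConvexOn.2 hx hz hxz hs ht hst
  have e : s • x + t • z - y = s • (x - y) + t • (z - y) := by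
    obtain rfl : t = 1 - s := by linarith
    module
  have e2 : finPart ψ y = s * finPart ψ y + t * finPart ψ y := by rw [← add_mul, hst, one_mul]
  simp only [bregmanReal, smul_eq_mul, e, inner_add_right, inner_smul_right] at h ⊢
  linarith

theorem bregmanReal_pos (hψ : IsGammaZero ψ) (hl : IsLegendre ψ) {x y : E}
    (hx : x ∈ intDom ψ) (hy : y ∈ intDom ψ) (hxy : x ≠ y) : 0 < bregmanReal ψ x y := by
  have h := (strictConvexOn_bregmanReal hl y).2 hx hy hxy (by norm_num : (0 : ℝ) < 1 / 2)
    (by norm_num : (0 : ℝ) < 1 / 2) (by norm_num)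
  have h2 := bregmanReal_nonneg hψ hl.essentiallySmooth (intDom_subset_dom
    (hψ.convex_intDom hx hy (by norm_num : (0 : ℝ) ≤ 1 / 2) (by norm_num : (0 : ℝ) ≤ 1 / 2)
      (by norm_num))) hy
  simp only [bregmanReal_self, smul_eq_mul] at h
  linarith

/-! ### Blow-up at the boundary of the domain -/

/-- For `x` in the interior of the domain, `D_ψ(x, y)` controls `‖∇ψ(y)‖`: testing the gradient
inequality at `y` with the point of a small ball around `x` lying in the direction of `∇ψ(y)`. -/
theorem exists_mul_norm_grad_le (hψ : IsGammaZero ψ) (hs : EssentiallySmooth ψ) {x : E}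
    (hx : x ∈ intDom ψ) :
    ∃ ε > 0, ∀ y ∈ intDom ψ, ε * ‖grad ψ y‖ ≤ bregmanReal ψ x y + 1 := by
  have hc : ∀ᶠ z in 𝓝 x, finPart ψ z < finPart ψ x + 1 :=
    (hs.differentiableAt x hx).continuousAt.eventually_lt continuousAt_const (by simp)
  obtain ⟨ε, hε, hball⟩ := Metric.nhds_basis_closedBall.eventually_iff.1
    (hc.and (intDom_mem_nhds hx))
  refine ⟨ε, hε, fun y hy => ?_⟩
  rcases eq_or_ne (grad ψ y) 0 with h0 | h0
  · have := bregmanReal_nonneg hψ hs (intDom_subset_dom hx) hy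
    rw [h0]; simp; linarith
  have hn : 0 < ‖grad ψ y‖ := norm_pos_iff.2 h0
  set u : E := (ε / ‖grad ψ y‖) • grad ψ y with hu
  have hun : ‖u‖ = ε := by
    rw [hu, norm_smul, Real.norm_of_nonneg (by positivity)]; field_simp
  have hui : inner ℝ (grad ψ y) u = ε * ‖grad ψ y‖ := by
    rw [hu, inner_smul_right, real_inner_self_eq_norm_sq]; field_simp
  have hmem := hball (show x + u ∈ Metric.closedBall x ε by simp [hun])
  have h := add_inner_grad_le hψ hs (intDom_subset_dom hmem.2) hy
  rw [show x + u - y = (x - y) + u by abel, inner_add_right, hui] at h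
  rw [bregmanReal]
  linarith [hmem.1]

/-- The blow-up of the gradient at any point outside the interior of the domain; away from the
closure of the interior the filter is trivial. -/
theorem eventually_lt_norm_grad (hs : EssentiallySmooth ψ) {z : E} (hz : z ∉ intDom ψ)
    (C : ℝ) : ∀ᶠ y in 𝓝[intDom ψ] z, C < ‖grad ψ y‖ := by
  rcases (𝓝[intDom ψ] z).eq_or_neBot with h | h
  · rw [h]; exact eventually_bot
  · exact (hs.blowup z (mem_frontier_dom hz h)).eventually_gt_atTop C

theorem continuousAt_bregmanReal_left (hs : EssentiallySmooth ψ) {x y : E}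
    (hx : x ∈ intDom ψ) : ContinuousAt (fun x => bregmanReal ψ x y) x := by
  have := (hs.differentiableAt x hx).continuousAt
  unfold bregmanReal
  fun_prop

theorem lowerSemicontinuous_bregman_left (hψ : IsGammaZero ψ) {y : E} (hy : y ∈ intDom ψ) :
    LowerSemicontinuous fun x => bregman ψ x y := by
  simp only [bregman_eq_sub hψ hy]
  refine hψ.lsc.add' (Continuous.lowerSemicontinuous ?_) fun x =>
    EReal.continuousAt_add (Or.inr (EReal.coe_ne_bot _)) (Or.inr (EReal.coe_ne_top _))
  exact continuous_coe_real_ereal.comp (by fun_prop)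

theorem lowerSemicontinuous_bregman_right (hψ : IsGammaZero ψ) (hs : EssentiallySmooth ψ)
    {x : E} (hx : x ∈ intDom ψ) (hc : ContinuousOn (finPart (bregman ψ x)) (intDom ψ)) :
    LowerSemicontinuous (bregman ψ x) := by
  intro z c hcz
  have heq : ∀ y ∈ intDom ψ, bregman ψ x y = (finPart (bregman ψ x) y : EReal) := fun y hy => by
    rw [bregman_eq_coe hψ (intDom_subset_dom hx) hy, finPart_bregman hψ (intDom_subset_dom hx) hy]
  by_cases hz : z ∈ intDom ψ
  · have h1 : ContinuousAt (fun y => (finPart (bregman ψ x) y : EReal)) z :=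
      continuous_coe_real_ereal.continuousAt.comp (hc.continuousAt (intDom_mem_nhds hz))
    rw [heq z hz] at hcz
    filter_upwards [h1.eventually_const_lt hcz, intDom_mem_nhds hz] with y hy hy'
    rwa [heq y hy']
  · have hct : c < ⊤ := by rwa [bregman_eq_top_of_notMem_intDom hz] at hcz
    obtain ⟨r, hr, -⟩ := EReal.lt_iff_exists_real_btwn.1 hct
    obtain ⟨ε, hε, h⟩ := exists_mul_norm_grad_le hψ hs hx
    have := eventually_lt_norm_grad hs hz ((r + 1) / ε)
    filter_upwards [eventually_nhdsWithin_iff.1 this] with y hy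
    by_cases hy' : y ∈ intDom ψ
    · rw [bregman_eq_coe hψ (intDom_subset_dom hx) hy']
      have h1 := hy hy'
      rw [div_lt_iff₀ hε] at h1
      refine hr.trans (EReal.coe_lt_coe_iff.2 ?_)
      linarith [h y hy', mul_comm ε ‖grad ψ y‖]
    · rwa [bregman_eq_top_of_notMem_intDom hy']

theorem coercive_bregman_left (hψ : IsGammaZero ψ) (hsup : Supercoercive ψ) {y : E}
    (hy : y ∈ intDom ψ) : Coercive fun x => bregman ψ x y := by
  unfold Coercive
  rw [EReal.tendsto_nhds_top_iff_real]
  intro r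
  set G := ‖grad ψ y‖
  have h1 : ∀ᶠ x in Bornology.cobounded E, ((G + 1 : ℝ) : EReal) < ψ x / ((‖x‖ : ℝ) : EReal) :=
    EReal.tendsto_nhds_top_iff_real.1 hsup _
  have h2 := tendsto_norm_cobounded_atTop.eventually_gt_atTop (α := E)
    (max 0 (r + finPart ψ y + G * ‖y‖))
  filter_upwards [h1, h2] with x hx1 hx2
  have hx0 := (le_max_left _ _).trans_lt hx2
  have hx3 := (le_max_right _ _).trans_lt hx2
  by_cases hx : x ∈ dom ψ
  · rw [bregman_eq_coe hψ hx hy, EReal.coe_lt_coe_iff, bregmanReal]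
    rw [← hψ.coe_finPart hx, ← EReal.coe_div, EReal.coe_lt_coe_iff, lt_div_iff₀ hx0] at hx1
    have h3 := real_inner_le_norm (grad ψ y) (x - y)
    have h4 : G * ‖x - y‖ ≤ G * (‖x‖ + ‖y‖) :=
      mul_le_mul_of_nonneg_left (norm_sub_le _ _) (norm_nonneg _)
    linarith
  · rw [bregman_eq_top_of_notMem_dom hψ hx]; exact EReal.coe_lt_top _

end Bregman

section Prox

variable {E : Type*} [NormedAddCommGroup E]

/-! ### Minimizers of the regularized objective -/

theorem exists_minimizer [ProperSpace E] {g K : E → EReal} {m c : ℝ} {y₀ : E}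
    (hm : ∀ x, (m : EReal) ≤ g x) (hg : LowerSemicontinuous g) (hK0 : ∀ x, 0 ≤ K x)
    (hK : LowerSemicontinuous K) (hKc : Coercive K) (hc : 0 < c) (hgy : g y₀ ≠ ⊤)
    (hKy : K y₀ ≠ ⊤) :
    ∃ p, (∀ q, g p + (c : EReal) * K p ≤ g q + (c : EReal) * K q) ∧
      g p + (c : EReal) * K p ≠ ⊥ ∧ g p + (c : EReal) * K p ≠ ⊤ := by
  have hgb : ∀ x, g x ≠ ⊥ := fun x => ((EReal.bot_lt_coe m).trans_le (hm x)).ne'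
  have hcK0 : ∀ x, 0 ≤ (c : EReal) * K x := fun x =>
    mul_nonneg (by exact_mod_cast hc.le) (hK0 x)
  have hF0 : ∀ x, (m : EReal) ≤ g x + (c : EReal) * K x := fun x => by
    simpa using add_le_add (hm x) (hcK0 x)
  have hcK : LowerSemicontinuous fun x => (c : EReal) * K x :=
    (show Continuous fun u : EReal => (c : EReal) * u from
      continuous_iff_continuousAt.2 fun u =>
        (EReal.continuousAt_mul (p := ((c : EReal), u)) (Or.inl (EReal.coe_ne_zero.2 hc.ne'))
          (Or.inl (EReal.coe_ne_zero.2 hc.ne')) (Or.inl (EReal.coe_ne_bot _))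
          (Or.inl (EReal.coe_ne_top _))).comp (by fun_prop)).comp_lowerSemicontinuous hK
      fun u v huv => mul_le_mul_of_nonneg_left huv (by exact_mod_cast hc.le)
  have hF : LowerSemicontinuous fun x => g x + (c : EReal) * K x :=
    hg.add' hcK fun x => EReal.continuousAt_add (Or.inr (ne_bot_of_nonneg (hcK0 x)))
      (Or.inl (hgb x))
  obtain ⟨r, hr⟩ : ∃ r : ℝ, g y₀ + (c : EReal) * K y₀ = r := by
    lift g y₀ to ℝ using ⟨hgy, hgb y₀⟩ with a
    lift K y₀ to ℝ using ⟨hKy, ne_bot_of_nonneg (hK0 y₀)⟩ with b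
    exact ⟨a + c * b, by norm_cast⟩
  have hev := EReal.tendsto_nhds_top_iff_real.1 hKc ((r - m) / c)
  obtain ⟨R, -, hR⟩ := (Metric.hasBasis_cobounded_compl_closedBall (0 : E)).eventually_iff.1 hev
  have hout : ∀ x ∉ Metric.closedBall (0 : E) R, (r : EReal) < g x + (c : EReal) * K x := by
    intro x hx
    have h1 := hR hx
    have hmx := hm x
    have hgx := hgb x
    have hK0x := hK0 x
    generalize g x = u at *
    generalize K x = v at *
    induction v with
    | bot => simp at hK0x
    | top => rw [EReal.coe_mul_top_of_pos hc, EReal.add_top_of_ne_bot hgx]; exact EReal.coe_lt_top r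
    | coe v =>
      rw [EReal.coe_lt_coe_iff, div_lt_iff₀ hc] at h1
      refine lt_of_lt_of_le ?_ (add_le_add_left hmx _)
      rw [← EReal.coe_mul, ← EReal.coe_add, EReal.coe_lt_coe_iff]
      linarith
  have hy₀ : y₀ ∈ Metric.closedBall (0 : E) R := by
    by_contra h
    exact (hout y₀ h).ne' hr
  obtain ⟨p, -, hp⟩ := LowerSemicontinuousOn.exists_isMinOn ⟨y₀, hy₀⟩
    (isCompact_closedBall (0 : E) R) (hF.lowerSemicontinuousOn _)
  have hpr : g p + (c : EReal) * K p ≤ r := (hp hy₀).trans_eq hr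
  refine ⟨p, fun q => ?_, ((EReal.bot_lt_coe m).trans_le (hF0 p)).ne',
    (hpr.trans_lt (EReal.coe_lt_top r)).ne⟩
  by_cases hq : q ∈ Metric.closedBall (0 : E) R
  · exact hp hq
  · exact hpr.trans (hout q hq).le

theorem ne_top_of_add_mul_ne_top {u v : EReal} {c : ℝ} (hu : u ≠ ⊥) (hv : 0 ≤ v) (hc : 0 < c)
    (h : u + (c : EReal) * v ≠ ⊤) : u ≠ ⊤ ∧ v ≠ ⊤ := by
  have h2 : (c : EReal) * v ≠ ⊥ :=
    ne_bot_of_nonneg (mul_nonneg (by exact_mod_cast hc.le) hv)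
  constructor
  · rintro rfl
    exact h (EReal.top_add_of_ne_bot h2)
  · rintro rfl
    exact h (by rw [EReal.coe_mul_top_of_pos hc, EReal.add_top_of_ne_bot hu])

theorem minimizer_unique {V : Type*} [AddCommGroup V] [Module ℝ V] {g K : V → EReal}
    {k : V → ℝ} {Y : Set V} {c : ℝ} {p q : V} (hg : EConvex g) (hgb : ∀ x, g x ≠ ⊥)
    (hk : StrictConvexOn ℝ Y k) (hK : ∀ x ∈ Y, K x = k x) (hc : 0 < c) (hp : p ∈ Y) (hq : q ∈ Y)
    (hpt : g p ≠ ⊤) (hqt : g q ≠ ⊤)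
    (hpmin : ∀ z, g p + (c : EReal) * K p ≤ g z + (c : EReal) * K z)
    (hqmin : ∀ z, g q + (c : EReal) * K q ≤ g z + (c : EReal) * K z) : p = q := by
  by_contra hne
  have hh : (0 : ℝ) < 1 / 2 := by norm_num
  have hs : (1 / 2 : ℝ) + 1 / 2 = 1 := by norm_num
  obtain ⟨a, ha⟩ : ∃ a : ℝ, g p = a := ⟨(g p).toReal, (EReal.coe_toReal hpt (hgb p)).symm⟩
  obtain ⟨b, hb⟩ : ∃ b : ℝ, g q = b := ⟨(g q).toReal, (EReal.coe_toReal hqt (hgb q)).symm⟩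
  have h1 := hk.2 hp hq hne hh hh hs
  have h2 := hg.le_combo ha.le hb.le hh.le hh.le hs
  have hmid := hk.1 hp hq hh.le hh.le hs
  have h3 := (hpmin _).trans (add_le_add_left h2 _)
  have h4 := (hqmin _).trans (add_le_add_left h2 _)
  rw [ha, hK p hp, hK _ hmid] at h3
  rw [hb, hK q hq, hK _ hmid] at h4
  norm_cast at h3 h4
  simp only [smul_eq_mul] at h1
  nlinarith [mul_lt_mul_of_pos_left h1 hc]

variable [InnerProductSpace ℝ E]

/-- A left proximal point lies in the interior of the domain of `ψ`. At a boundary point `p`,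
minimality along the segment from `p` to an interior point `y₀` of `dom g` bounds the directional
derivatives of `ψ` from below, which keeps the gradients bounded as the segment approaches `p`. -/
theorem mem_intDom_of_minimizer [CompleteSpace E] {g ψ : E → EReal} {c : ℝ} {p x y₀ : E}
    (hg : EConvex g)
    (hgb : ∀ x, g x ≠ ⊥) (hψ : IsGammaZero ψ) (hs : EssentiallySmooth ψ) (hc : 0 < c)
    (hx : x ∈ intDom ψ) (hy₀ : y₀ ∈ intDom ψ) (hgy₀ : g y₀ ≠ ⊤) (hgp : g p ≠ ⊤)
    (hp : p ∈ dom ψ)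
    (hmin : ∀ z, g p + (c : EReal) * bregman ψ p x ≤ g z + (c : EReal) * bregman ψ z x) :
    p ∈ intDom ψ := by
  by_contra hpY
  obtain ⟨a, ha⟩ : ∃ a : ℝ, g p = a := ⟨(g p).toReal, (EReal.coe_toReal hgp (hgb p)).symm⟩
  obtain ⟨b, hb⟩ : ∃ b : ℝ, g y₀ = b := ⟨(g y₀).toReal, (EReal.coe_toReal hgy₀ (hgb y₀)).symm⟩
  obtain ⟨ε, hε, hkey⟩ := exists_mul_norm_grad_le hψ hs hy₀
  set z : ℝ → E := fun t => (1 - t) • p + t • y₀ with hz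
  have hzY : ∀ t ∈ Ioo (0 : ℝ) 1, z t ∈ intDom ψ := fun t ht => by
    have := hψ.convex_dom.combo_self_interior_mem_interior hp hy₀
      (sub_nonneg.2 ht.2.le) ht.1 (by ring)
    exact this
  -- `A` is minus the slope at which minimality can let `ψ` decrease along the segment
  set A : ℝ := (b - a) / c + |inner ℝ (grad ψ x) (y₀ - p)| with hA
  have hdec : ∀ t ∈ Ioo (0 : ℝ) 1, -(t * A) ≤ finPart ψ (z t) - finPart ψ p := by
    intro t ht
    have h1 := hg.le_combo ha.le hb.le (sub_nonneg.2 ht.2.le) ht.1.le (by ring)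
    have h2 := (hmin (z t)).trans (add_le_add_left h1 _)
    rw [ha, bregman_eq_coe hψ hp hx, bregman_eq_coe hψ (intDom_subset_dom (hzY t ht)) hx] at h2
    norm_cast at h2
    have h3 : z t - x = (p - x) + t • (y₀ - p) := by simp only [hz]; module
    rw [bregmanReal, bregmanReal, h3, inner_add_right, inner_smul_right] at h2
    have h4 := mul_le_mul_of_nonneg_left (neg_le_abs (inner ℝ (grad ψ x) (y₀ - p))) ht.1.le
    have h5 : -(t * ((b - a) / c)) ≤
        finPart ψ (z t) - finPart ψ p - t * inner ℝ (grad ψ x) (y₀ - p) := by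
      rw [← mul_div_assoc, ← neg_div, div_le_iff₀ hc]
      linarith
    rw [hA]
    linarith
  have hbd : ∀ t ∈ Ioo (0 : ℝ) 1,
      ‖grad ψ (z t)‖ ≤ (finPart ψ y₀ - finPart ψ p + 2 * |A| + 1) / ε := by
    intro t ht
    have h1 := hkey (z t) (hzY t ht)
    have h2 := hdec t ht
    have h3 := add_inner_grad_le hψ hs hp (hzY t ht)
    have e1 : p - z t = -(t • (y₀ - p)) := by simp only [hz]; module
    have e2 : y₀ - z t = (1 - t) • (y₀ - p) := by simp only [hz]; module
    rw [e1, inner_neg_right, inner_smul_right] at h3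
    rw [bregmanReal, e2, inner_smul_right] at h1
    have h4 : -A ≤ inner ℝ (grad ψ (z t)) (y₀ - p) := by
      refine le_of_mul_le_mul_left ?_ ht.1
      linarith
    have h5 : (1 - t) * -inner ℝ (grad ψ (z t)) (y₀ - p) ≤ |A| := by
      have h6 := le_abs_self A
      have h7 : (1 - t) * -inner ℝ (grad ψ (z t)) (y₀ - p) ≤ (1 - t) * |A| :=
        mul_le_mul_of_nonneg_left (by linarith) (by linarith [ht.2])
      nlinarith [abs_nonneg A, ht.1]
    have h8 : t * A ≤ |A| := by nlinarith [abs_nonneg A, le_abs_self A, ht.1, ht.2]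
    rw [le_div_iff₀ hε]
    linarith
  have hcont : Tendsto z (𝓝[>] 0) (𝓝[intDom ψ] p) := by
    refine tendsto_nhdsWithin_iff.2 ⟨?_, ?_⟩
    · have : Continuous z := by fun_prop
      simpa [hz] using (this.tendsto 0).mono_left nhdsWithin_le_nhds
    · filter_upwards [Ioo_mem_nhdsGT (zero_lt_one' ℝ)] with t ht using hzY t ht
  have hlt := hcont.eventually (eventually_lt_norm_grad hs hpY
    ((finPart ψ y₀ - finPart ψ p + 2 * |A| + 1) / ε))
  obtain ⟨t, ht1, ht2⟩ := (hlt.and (Ioo_mem_nhdsGT (zero_lt_one' ℝ))).exists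
  exact absurd (hbd t ht2) (not_le.2 ht1)

/-! ### Derivatives of the Bregman divergence -/

variable [CompleteSpace E] {ψ : E → EReal}

theorem hasFDerivAt_grad (hsm : ContDiffOn ℝ 3 (finPart ψ) (intDom ψ)) {y : E}
    (hy : y ∈ intDom ψ) : HasFDerivAt (grad ψ) (hess ψ y) y := by
  have h1 : ContDiffAt ℝ 3 (finPart ψ) y := hsm.contDiffAt (intDom_mem_nhds hy)
  have h2 : DifferentiableAt ℝ (fderiv ℝ (finPart ψ)) y :=
    (h1.fderiv_right (m := 1) (by norm_num)).differentiableAt (by norm_num)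
  have h3 : DifferentiableAt ℝ (grad ψ) y :=
    (InnerProductSpace.toDual ℝ E).symm.toContinuousLinearEquiv.differentiableAt.comp y h2
  exact h3.hasFDerivAt

theorem inner_hess_comm (hsm : ContDiffOn ℝ 3 (finPart ψ) (intDom ψ)) {y : E}
    (hy : y ∈ intDom ψ) (v w : E) :
    inner ℝ (hess ψ y v) w = inner ℝ (hess ψ y w) v := by
  have h1 : ContDiffAt ℝ 3 (finPart ψ) y := hsm.contDiffAt (intDom_mem_nhds hy)
  have h2 : DifferentiableAt ℝ (fderiv ℝ (finPart ψ)) y :=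
    (h1.fderiv_right (m := 1) (by norm_num)).differentiableAt (by norm_num)
  have key : ∀ v w, inner ℝ (hess ψ y v) w = fderiv ℝ (fderiv ℝ (finPart ψ)) y v w := by
    intro v w
    have e1 : HasFDerivAt (fun x => inner ℝ (grad ψ x) w) _ y :=
      (hasFDerivAt_grad hsm hy).inner ℝ (hasFDerivAt_const w y)
    have e2 : HasFDerivAt (fun x => fderiv ℝ (finPart ψ) x w) _ y :=
      h2.hasFDerivAt.clm_apply (hasFDerivAt_const w y)
    have e3 : (fun x => inner ℝ (grad ψ x) w) = fun x => fderiv ℝ (finPart ψ) x w := by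
      funext x
      rw [grad, ← toDual_gradient, InnerProductSpace.toDual_apply_apply]
    rw [e3] at e1
    simpa using congrArg (fun L => L v) (e1.unique e2)
  rw [key, key]
  exact (h1.isSymmSndFDerivAt (by simp; norm_num)).eq v w

theorem hasFDerivAt_bregmanReal (hs : EssentiallySmooth ψ)
    (hsm : ContDiffOn ℝ 3 (finPart ψ) (intDom ψ)) {x y : E} (hx : x ∈ intDom ψ)
    (hy : y ∈ intDom ψ) :
    HasFDerivAt (fun q : E × E => bregmanReal ψ q.1 q.2)
      ((innerSL ℝ (grad ψ x - grad ψ y)).comp (ContinuousLinearMap.fst ℝ E E) +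
        (innerSL ℝ (hess ψ y (y - x))).comp (ContinuousLinearMap.snd ℝ E E)) (x, y) := by
  have h1 : HasFDerivAt (fun q : E × E => finPart ψ q.1) _ (x, y) :=
    HasFDerivAt.comp (x, y) (f := Prod.fst) (hs.hasGradientAt hx).hasFDerivAt hasFDerivAt_fst
  have h2 : HasFDerivAt (fun q : E × E => finPart ψ q.2) _ (x, y) :=
    HasFDerivAt.comp (x, y) (f := Prod.snd) (hs.hasGradientAt hy).hasFDerivAt hasFDerivAt_snd
  have h3 : HasFDerivAt (fun q : E × E => grad ψ q.2) _ (x, y) :=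
    HasFDerivAt.comp (x, y) (f := Prod.snd) (hasFDerivAt_grad hsm hy) hasFDerivAt_snd
  have h4 := (h1.sub h2).sub (h3.inner ℝ (hasFDerivAt_fst.sub hasFDerivAt_snd))
  refine h4.congr_fderiv ?_
  ext v
  all_goals simp [inner_sub_left, inner_sub_right, inner_hess_comm hsm hy v]

theorem hasGradientAt_bregmanReal_left (hs : EssentiallySmooth ψ)
    (hsm : ContDiffOn ℝ 3 (finPart ψ) (intDom ψ)) {x y : E} (hx : x ∈ intDom ψ)
    (hy : y ∈ intDom ψ) :
    HasGradientAt (fun x => bregmanReal ψ x y) (grad ψ x - grad ψ y) x := by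
  rw [hasGradientAt_iff_hasFDerivAt]
  refine ((hasFDerivAt_bregmanReal hs hsm hx hy).comp x (f := fun x => (x, y))
    (hasFDerivAt_prodMk_left x y)).congr_fderiv ?_
  ext v; simp

theorem hasGradientAt_bregmanReal_right (hs : EssentiallySmooth ψ)
    (hsm : ContDiffOn ℝ 3 (finPart ψ) (intDom ψ)) {x y : E} (hx : x ∈ intDom ψ)
    (hy : y ∈ intDom ψ) :
    HasGradientAt (fun y => bregmanReal ψ x y) (hess ψ y (y - x)) y := by
  rw [hasGradientAt_iff_hasFDerivAt]
  refine ((hasFDerivAt_bregmanReal hs hsm hx hy).comp y (f := fun y => (x, y))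
    (hasFDerivAt_prodMk_right x y)).congr_fderiv ?_
  ext v; simp

end Prox

section Envelope

variable {E : Type*} [NormedAddCommGroup E] [InnerProductSpace ℝ E]
variable {g ψ : E → EReal}

section CompleteSpace

variable [CompleteSpace E]

/-! ### Jointly convex divergences with Lipschitz gradient -/

/-- A Lipschitz gradient cannot blow up at a boundary point, so the domain has no boundary. -/
theorem intDom_eq_univ (hs : EssentiallySmooth ψ) {L : ℝ≥0}
    (hL : LipschitzOnWith L (grad ψ) (intDom ψ)) : intDom ψ = univ := by
  refine IsClopen.eq_univ ⟨?_, isOpen_interior⟩ hs.nonempty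
  rw [← closure_subset_iff_isClosed]
  intro z hz
  by_contra hzY
  obtain ⟨w, hw⟩ := hs.nonempty
  have := mem_closure_iff_nhdsWithin_neBot.1 hz
  have h1 := eventually_lt_norm_grad hs hzY (‖grad ψ w‖ + L * (‖z - w‖ + 1))
  have h2 : ∀ᶠ y in 𝓝[intDom ψ] z, ‖y - w‖ < ‖z - w‖ + 1 :=
    nhdsWithin_le_nhds ((show Continuous fun y => ‖y - w‖ by fun_prop).continuousAt.eventually_lt
      continuousAt_const (by simp))
  obtain ⟨y, ⟨hy1, hy2⟩, hy3⟩ := ((h1.and h2).and self_mem_nhdsWithin).exists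
  have h3 := hL.norm_sub_le hy3 hw
  have h4 := norm_sub_norm_le (grad ψ y) (grad ψ w)
  have h5 : (L : ℝ) * ‖y - w‖ ≤ L * (‖z - w‖ + 1) :=
    mul_le_mul_of_nonneg_left hy2.le L.2
  linarith

/-- If `D_ψ` is jointly convex and finite everywhere, then `∇ψ` is affine: the affine minorant of
`D_ψ` at `(x, y)` is nonpositive along the diagonal, where `D_ψ` vanishes, hence constant there. -/
theorem grad_sub_grad_eq_hess (hψ : IsGammaZero ψ) (hs : EssentiallySmooth ψ)
    (hsm : ContDiffOn ℝ 3 (finPart ψ) (intDom ψ))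
    (hD : EConvex fun p : E × E => bregman ψ p.1 p.2) (huniv : intDom ψ = univ) (x y : E) :
    grad ψ x - grad ψ y = hess ψ y (x - y) := by
  have hY : ∀ z, z ∈ intDom ψ := fun z => huniv ▸ mem_univ z
  have heq : ∀ p : E × E, bregman ψ p.1 p.2 = (bregmanReal ψ p.1 p.2 : EReal) := fun p =>
    bregman_eq_coe hψ (intDom_subset_dom (hY _)) (hY _)
  have hconv : ConvexOn ℝ univ fun p : E × E => bregmanReal ψ p.1 p.2 := by
    have h := hD.convexOn_finPart (S := univ) convex_univ
      (fun p _ => by change bregman ψ p.1 p.2 < ⊤; rw [heq]; exact EReal.coe_lt_top _)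
      (fun p _ => by rw [heq]; exact EReal.coe_ne_bot _)
    exact h.congr fun p _ => by simp only [finPart, heq, EReal.toReal_coe]
  set w := grad ψ x - grad ψ y - hess ψ y (x - y) with hw
  have key : ∀ z, bregmanReal ψ x y + inner ℝ (grad ψ x - grad ψ y) (z - x) -
      inner ℝ (hess ψ y (x - y)) (z - y) ≤ 0 := by
    intro z
    have h := convexOn_add_fderiv_le hconv (mem_univ (z, z)) (mem_univ (x, y))
      (hasFDerivAt_bregmanReal hs hsm (hY x) (hY y))
    have e : hess ψ y (y - x) = -hess ψ y (x - y) := by rw [← map_neg, neg_sub]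
    simp only [bregmanReal_self, Prod.mk_sub_mk, add_apply,
      ContinuousLinearMap.comp_apply, ContinuousLinearMap.coe_fst',
      ContinuousLinearMap.coe_snd', innerSL_apply_apply, e, inner_neg_left] at h
    linarith
  -- the bound `key` is affine in `z` with linear part `⟪w, z⟫`; at this multiple of `w` it is `1`
  have hw0 : inner ℝ w w = 0 := by
    by_contra hne
    have hp : 0 < inner ℝ w w := lt_of_le_of_ne real_inner_self_nonneg (Ne.symm hne)
    set c := bregmanReal ψ x y - inner ℝ (grad ψ x - grad ψ y) x + inner ℝ (hess ψ y (x - y)) y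
    have h := key (((1 - c) / inner ℝ w w) • w)
    have h2 : inner ℝ w (((1 - c) / inner ℝ w w) • w) = 1 - c := by
      rw [inner_smul_right]; field_simp
    conv at h2 => lhs; arg 2; rw [hw]
    rw [inner_sub_left] at h2
    rw [inner_sub_right (grad ψ x - grad ψ y), inner_sub_right (hess ψ y (x - y))] at h
    linarith
  exact sub_eq_zero.1 (inner_self_eq_zero.1 hw0)

theorem bregman_comm (hψ : IsGammaZero ψ) (hs : EssentiallySmooth ψ)
    (hsm : ContDiffOn ℝ 3 (finPart ψ) (intDom ψ))
    (hD : EConvex fun p : E × E => bregman ψ p.1 p.2) (huniv : intDom ψ = univ) (x y : E) :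
    bregman ψ x y = bregman ψ y x := by
  have hY : ∀ z, z ∈ intDom ψ := fun z => huniv ▸ mem_univ z
  have hd : ∀ z,
      HasFDerivAt (fun z => bregmanReal ψ z y - bregmanReal ψ y z) (0 : E →L[ℝ] ℝ) z := by
    intro z
    have h := (hasGradientAt_bregmanReal_left hs hsm (hY z) (hY y)).hasFDerivAt.sub
      (hasGradientAt_bregmanReal_right hs hsm (hY y) (hY z)).hasFDerivAt
    have e := grad_sub_grad_eq_hess hψ hs hsm hD huniv y z
    rw [← neg_sub z y, map_neg] at e
    rw [← map_sub, ← neg_sub (grad ψ y), e, neg_neg, sub_self, map_zero] at h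
    exact h
  have h := is_const_of_fderiv_eq_zero (𝕜 := ℝ) (fun z => (hd z).differentiableAt)
    (fun z => (hd z).fderiv) x y
  simp only [sub_self] at h
  rw [bregman_eq_coe hψ (intDom_subset_dom (hY _)) (hY _),
    bregman_eq_coe hψ (intDom_subset_dom (hY _)) (hY _), sub_eq_zero.1 h]

/-! ### Well-posedness and gradients of the envelopes -/

/-- The gradient of a partial infimum of a jointly convex function is that of the function with
the minimizer `p` at `y` frozen. -/
theorem hasGradientAt_iInf {Φ : E → E → EReal} (hΦ : EConvex fun q : E × E => Φ q.1 q.2)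
    {Y : Set E} (hY : Convex ℝ Y)
    (hmin : ∀ x ∈ Y, ∃ p, (∀ q, Φ p x ≤ Φ q x) ∧ Φ p x ≠ ⊥ ∧ Φ p x ≠ ⊤) {y p G : E}
    (hy : Y ∈ 𝓝 y) (hp : ∀ q, Φ p y ≤ Φ q y) {h : E → ℝ} (hh : HasGradientAt h G y)
    (hΦh : ∀ᶠ x in 𝓝 y, Φ p x = h x) : HasGradientAt (finPart fun x => ⨅ q, Φ q x) G y := by
  rw [hasGradientAt_iff_hasFDerivAt]
  refine hasFDerivAt_of_convexOn_of_le (hΦ.convexOn_iInf hY hmin) hy ?_ ?_ hh.hasFDerivAt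
  · filter_upwards [hΦh, hy] with x hx hxY
    obtain ⟨q, hq, hb, -⟩ := hmin x hxY
    have h1 : (⨅ q, Φ q x) ≤ h x := (iInf_le _ p).trans hx.le
    have h2 : (⨅ q, Φ q x) ≠ ⊥ := by
      rw [le_antisymm (iInf_le _ q) (le_iInf hq)]
      exact hb
    rw [finPart, ← EReal.coe_le_coe_iff,
      EReal.coe_toReal (h1.trans_lt (EReal.coe_lt_top _)).ne h2]
    exact h1
  · have h1 : (⨅ q, Φ q y) = h y := by
      rw [← hΦh.self_of_nhds]
      exact le_antisymm (iInf_le _ p) (le_iInf hp)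
    rw [finPart, h1, EReal.toReal_coe]

theorem eConvex_leftObj (hg : IsGammaZero g) (hψ : IsGammaZero ψ) (hs : EssentiallySmooth ψ)
    (hD : EConvex fun p : E × E => bregman ψ p.1 p.2) {lam : ℝ} (hlam : 0 < lam) :
    EConvex fun q : E × E => leftObj lam g ψ q.2 q.1 :=
  (hg.convex.comp_linearMap (LinearMap.fst ℝ E E)).add
    (hD.const_mul (fun _ => bregman_ne_bot hψ hs _ _) (one_div_pos.2 hlam))
    (fun _ => hg.ne_bot _) fun _ => ne_bot_of_nonneg
      (mul_nonneg (by exact_mod_cast (one_div_pos.2 hlam).le) (bregman_nonneg hψ hs _ _))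

theorem eConvex_rightObj (hg : IsGammaZero g) (hψ : IsGammaZero ψ) (hs : EssentiallySmooth ψ)
    (hD : EConvex fun p : E × E => bregman ψ p.1 p.2) {lam : ℝ} (hlam : 0 < lam) :
    EConvex fun q : E × E => rightObj lam g ψ q.2 q.1 :=
  (hg.convex.comp_linearMap (LinearMap.fst ℝ E E)).add
    ((hD.comp_linearMap (LinearEquiv.prodComm ℝ E E).toLinearMap).const_mul
      (fun _ => bregman_ne_bot hψ hs _ _) (one_div_pos.2 hlam))
    (fun _ => hg.ne_bot _) fun _ => ne_bot_of_nonneg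
      (mul_nonneg (by exact_mod_cast (one_div_pos.2 hlam).le) (bregman_nonneg hψ hs _ _))

theorem rightObj_eq_coe (hg : IsGammaZero g) (hψ : IsGammaZero ψ) {lam : ℝ}
    {x p : E} (hx : x ∈ intDom ψ) (hpY : p ∈ intDom ψ) (hgp : g p ≠ ⊤) :
    rightObj lam g ψ x p = (((g p).toReal + (1 / lam) * bregmanReal ψ x p : ℝ) : EReal) := by
  rw [rightObj, bregman_eq_coe hψ (intDom_subset_dom hx) hpY, EReal.coe_add, EReal.coe_mul,
    EReal.coe_toReal hgp (hg.ne_bot p)]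

end CompleteSpace

variable [ProperSpace E]

theorem exists_leftProx (hg : IsGammaZero g) (hg_bdd : ∃ m : ℝ, ∀ x, (m : EReal) ≤ g x)
    (hψ : IsGammaZero ψ) (hl : IsLegendre ψ) (hsup : Supercoercive ψ)
    (h_dom : (dom g ∩ intDom ψ).Nonempty) {lam : ℝ} (hlam : 0 < lam) {x : E}
    (hx : x ∈ intDom ψ) :
    ∃ p ∈ intDom ψ, leftProx lam g ψ x = {p} ∧ g p ≠ ⊤ ∧
      (∀ q, leftObj lam g ψ x p ≤ leftObj lam g ψ x q) ∧
      leftObj lam g ψ x p ≠ ⊥ ∧ leftObj lam g ψ x p ≠ ⊤ := by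
  obtain ⟨m, hm⟩ := hg_bdd
  obtain ⟨y₀, hgy₀, hy₀⟩ := h_dom
  have hs := hl.essentiallySmooth
  have hc : 0 < 1 / lam := one_div_pos.2 hlam
  obtain ⟨p, hp, hpb, hpt⟩ := exists_minimizer (y₀ := y₀) hm hg.lsc
    (fun z => bregman_nonneg hψ hs z x) (lowerSemicontinuous_bregman_left hψ hx)
    (coercive_bregman_left hψ hsup hx) hc (ne_of_lt hgy₀)
    (by rw [bregman_eq_coe hψ (intDom_subset_dom hy₀) hx]; exact EReal.coe_ne_top _)
  have hfin : ∀ q, (∀ z, leftObj lam g ψ x q ≤ leftObj lam g ψ x z) →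
      g q ≠ ⊤ ∧ q ∈ intDom ψ := by
    intro q hq
    have hqt : leftObj lam g ψ x q ≠ ⊤ := ((hq p).trans_lt hpt.lt_top).ne
    obtain ⟨h1, h2⟩ := ne_top_of_add_mul_ne_top (hg.ne_bot q) (bregman_nonneg hψ hs q x) hc hqt
    exact ⟨h1, mem_intDom_of_minimizer hg.convex hg.ne_bot hψ hs hc hx hy₀ (ne_of_lt hgy₀) h1
      (mem_dom_of_bregman_ne_top hψ h2) hq⟩
  obtain ⟨hgp, hpY⟩ := hfin p hp
  refine ⟨p, hpY, ?_, hgp, hp, hpb, hpt⟩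
  refine Subset.antisymm (fun q hq => ?_) (singleton_subset_iff.2 hp)
  obtain ⟨hgq, hqY⟩ := hfin q hq
  exact minimizer_unique hg.convex hg.ne_bot (strictConvexOn_bregmanReal hl x)
    (fun z hz => bregman_eq_coe hψ (intDom_subset_dom hz) hx) hc hqY hpY hgq hgp hq hp

theorem exists_rightProx (hg : IsGammaZero g) (hg_bdd : ∃ m : ℝ, ∀ x, (m : EReal) ≤ g x)
    (hψ : IsGammaZero ψ) (hs : EssentiallySmooth ψ) (h_dom : (dom g ∩ intDom ψ).Nonempty)
    {lam : ℝ} (hlam : 0 < lam) {x : E} (hx : x ∈ intDom ψ)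
    (hst : StrictConvexOn ℝ (intDom ψ) (finPart (bregman ψ x)))
    (hcont : ContinuousOn (finPart (bregman ψ x)) (intDom ψ)) (hcoer : Coercive (bregman ψ x)) :
    ∃ p ∈ intDom ψ, rightProx lam g ψ x = {p} ∧ g p ≠ ⊤ ∧
      (∀ q, rightObj lam g ψ x p ≤ rightObj lam g ψ x q) ∧
      rightObj lam g ψ x p ≠ ⊥ ∧ rightObj lam g ψ x p ≠ ⊤ := by
  obtain ⟨m, hm⟩ := hg_bdd
  obtain ⟨y₀, hgy₀, hy₀⟩ := h_dom
  have hc : 0 < 1 / lam := one_div_pos.2 hlam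
  have hxd := intDom_subset_dom hx
  obtain ⟨p, hp, hpb, hpt⟩ := exists_minimizer (y₀ := y₀) hm hg.lsc
    (fun z => bregman_nonneg hψ hs x z) (lowerSemicontinuous_bregman_right hψ hs hx hcont)
    hcoer hc (ne_of_lt hgy₀) (by rw [bregman_eq_coe hψ hxd hy₀]; exact EReal.coe_ne_top _)
  have hfin : ∀ q, (∀ z, rightObj lam g ψ x q ≤ rightObj lam g ψ x z) →
      g q ≠ ⊤ ∧ q ∈ intDom ψ := by
    intro q hq
    have hqt : rightObj lam g ψ x q ≠ ⊤ := ((hq p).trans_lt hpt.lt_top).ne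
    obtain ⟨h1, h2⟩ := ne_top_of_add_mul_ne_top (hg.ne_bot q) (bregman_nonneg hψ hs x q) hc hqt
    exact ⟨h1, mem_intDom_of_bregman_ne_top h2⟩
  obtain ⟨hgp, hpY⟩ := hfin p hp
  refine ⟨p, hpY, ?_, hgp, hp, hpb, hpt⟩
  refine Subset.antisymm (fun q hq => ?_) (singleton_subset_iff.2 hp)
  obtain ⟨hgq, hqY⟩ := hfin q hq
  exact minimizer_unique hg.convex hg.ne_bot hst
    (fun z hz => by rw [finPart_bregman hψ hxd hz, bregman_eq_coe hψ hxd hz]) hc hqY hpY hgq hgp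
    hq hp

theorem hasGradientAt_leftEnv (hg : IsGammaZero g) (hg_bdd : ∃ m : ℝ, ∀ x, (m : EReal) ≤ g x)
    (hψ : IsGammaZero ψ) (hl : IsLegendre ψ) (hsm : ContDiffOn ℝ 3 (finPart ψ) (intDom ψ))
    (hsup : Supercoercive ψ) (h_dom : (dom g ∩ intDom ψ).Nonempty)
    (hD : EConvex fun p : E × E => bregman ψ p.1 p.2) {lam : ℝ} (hlam : 0 < lam) {y p : E}
    (hy : y ∈ intDom ψ) (hpY : p ∈ intDom ψ) (hgp : g p ≠ ⊤)
    (hp : ∀ q, leftObj lam g ψ y p ≤ leftObj lam g ψ y q) :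
    HasGradientAt (finPart (leftEnv lam g ψ)) ((1 / lam) • hess ψ y (y - p)) y := by
  have hs := hl.essentiallySmooth
  have h1 : HasGradientAt (fun x => (g p).toReal + (1 / lam) * bregmanReal ψ p x)
      ((1 / lam) • hess ψ y (y - p)) y := by
    rw [hasGradientAt_iff_hasFDerivAt, map_smul]
    exact ((hasGradientAt_bregmanReal_right hs hsm hpY hy).hasFDerivAt.const_mul _).const_add _
  refine hasGradientAt_iInf (eConvex_leftObj hg hψ hs hD hlam) hψ.convex_intDom (fun x hx => ?_)
    (intDom_mem_nhds hy) hp h1 ?_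
  · obtain ⟨q, -, -, -, hq⟩ := exists_leftProx hg hg_bdd hψ hl hsup h_dom hlam hx
    exact ⟨q, hq⟩
  · filter_upwards [intDom_mem_nhds hy] with x hx
    rw [leftObj, bregman_eq_coe hψ (intDom_subset_dom hpY) hx, EReal.coe_add, EReal.coe_mul,
      EReal.coe_toReal hgp (hg.ne_bot p)]

theorem exists_rightObj_minimizer (hg : IsGammaZero g)
    (hg_bdd : ∃ m : ℝ, ∀ x, (m : EReal) ≤ g x)
    (hψ : IsGammaZero ψ) (hs : EssentiallySmooth ψ) (h_dom : (dom g ∩ intDom ψ).Nonempty)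
    (hst : ∀ y ∈ intDom ψ, StrictConvexOn ℝ (intDom ψ) (finPart (bregman ψ y)))
    (hcont : ∀ y ∈ intDom ψ, ContinuousOn (finPart (bregman ψ y)) (intDom ψ))
    (hcoer : ∀ y ∈ intDom ψ, Coercive (bregman ψ y)) {lam : ℝ} (hlam : 0 < lam) :
    ∀ x ∈ intDom ψ, ∃ p, (∀ q, rightObj lam g ψ x p ≤ rightObj lam g ψ x q) ∧
      rightObj lam g ψ x p ≠ ⊥ ∧ rightObj lam g ψ x p ≠ ⊤ := fun x hx => by
  obtain ⟨q, -, -, -, hq⟩ := exists_rightProx hg hg_bdd hψ hs h_dom hlam hx (hst x hx)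
    (hcont x hx) (hcoer x hx)
  exact ⟨q, hq⟩

theorem hasGradientAt_rightEnv (hg : IsGammaZero g) (hψ : IsGammaZero ψ)
    (hs : EssentiallySmooth ψ) (hsm : ContDiffOn ℝ 3 (finPart ψ) (intDom ψ))
    (hD : EConvex fun p : E × E => bregman ψ p.1 p.2) {lam : ℝ} (hlam : 0 < lam)
    (hmin : ∀ x ∈ intDom ψ, ∃ p, (∀ q, rightObj lam g ψ x p ≤ rightObj lam g ψ x q) ∧
      rightObj lam g ψ x p ≠ ⊥ ∧ rightObj lam g ψ x p ≠ ⊤) {y p : E}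
    (hy : y ∈ intDom ψ) (hpY : p ∈ intDom ψ) (hgp : g p ≠ ⊤)
    (hp : ∀ q, rightObj lam g ψ y p ≤ rightObj lam g ψ y q) :
    HasGradientAt (finPart (rightEnv lam g ψ)) ((1 / lam) • (grad ψ y - grad ψ p)) y := by
  have h1 : HasGradientAt (fun x => (g p).toReal + (1 / lam) * bregmanReal ψ x p)
      ((1 / lam) • (grad ψ y - grad ψ p)) y := by
    rw [hasGradientAt_iff_hasFDerivAt, map_smul]
    exact ((hasGradientAt_bregmanReal_left hs hsm hy hpY).hasFDerivAt.const_mul _).const_add _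
  refine hasGradientAt_iInf (eConvex_rightObj hg hψ hs hD hlam) hψ.convex_intDom hmin
    (intDom_mem_nhds hy) hp h1 ?_
  filter_upwards [intDom_mem_nhds hy] with x hx using rightObj_eq_coe hg hψ hx hpY hgp

/-! ### Limit of the envelopes -/

/-- A convex function vanishing at `y` and positive elsewhere near `y` is bounded away from zero
off every ball around `y`. -/
theorem exists_pos_le_of_dist {K : E → EReal} {k : E → ℝ} {Y : Set E} {y : E} (hK : EConvex K)
    (hKy : K y = 0) (hY : Y ∈ 𝓝 y) (hk : ContinuousOn k Y) (hKk : ∀ z ∈ Y, K z = k z)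
    (hpos : ∀ z ∈ Y, z ≠ y → 0 < k z) {r : ℝ} (hr : 0 < r) :
    ∃ δ : ℝ, 0 < δ ∧ ∀ z, r ≤ ‖z - y‖ → (δ : EReal) ≤ K z := by
  obtain ⟨ρ, hρ, hρY⟩ := Metric.nhds_basis_closedBall.mem_iff.1 hY
  set s := min ρ r
  have hs : 0 < s := lt_min hρ hr
  have hsub : Metric.sphere y s ⊆ Y := fun z hz =>
    hρY (by rw [Metric.mem_closedBall, Metric.mem_sphere.1 hz]; exact min_le_left _ _)
  obtain ⟨δ, hδ, hδk⟩ : ∃ δ : ℝ, 0 < δ ∧ ∀ z ∈ Metric.sphere y s, δ ≤ k z := by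
    rcases (Metric.sphere y s).eq_empty_or_nonempty with h | h
    · exact ⟨1, one_pos, by simp [h]⟩
    · obtain ⟨w, hw, hmin⟩ := (isCompact_sphere y s).exists_isMinOn h (hk.mono hsub)
      exact ⟨k w, hpos w (hsub hw) (Metric.ne_of_mem_sphere hw hs.ne'), fun z hz => hmin hz⟩
  refine ⟨δ, hδ, fun z hz => ?_⟩
  by_contra! hlt
  obtain ⟨b, hb, hbδ⟩ := EReal.lt_iff_exists_real_btwn.1 hlt
  have hzr : 0 < ‖z - y‖ := hr.trans_le hz
  have ht1 : s / ‖z - y‖ ≤ 1 := (div_le_one hzr).2 ((min_le_right _ _).trans hz)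
  have ht0 : 0 < s / ‖z - y‖ := by positivity
  set t := s / ‖z - y‖ with ht
  have hw : (1 - t) • y + t • z ∈ Metric.sphere y s := by
    rw [mem_sphere_iff_norm, show (1 - t) • y + t • z - y = t • (z - y) by module, norm_smul,
      Real.norm_of_nonneg ht0.le, ht]
    field_simp
  have h1 := hK.le_combo (a := 0) (by rw [hKy]; rfl) hb.le (sub_nonneg.2 ht1) ht0.le (by ring)
  rw [hKk _ (hsub hw), EReal.coe_le_coe_iff] at h1
  have h2 := hδk _ hw
  have h3 : b < δ := by exact_mod_cast hbδ
  nlinarith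

theorem antitoneOn_iInf_add_mul {V : Type*} {g K : V → EReal} (hK : ∀ z, 0 ≤ K z) :
    AntitoneOn (fun lam : ℝ => ⨅ z, (g z + ((1 / lam : ℝ) : EReal) * K z)) (Ioi 0) := by
  intro l hl l' _ hll
  refine iInf_mono fun z => add_le_add_right (mul_le_mul_of_nonneg_right ?_ (hK z)) _
  exact_mod_cast one_div_le_one_div_of_le hl hll

theorem tendsto_iInf_add_mul {K : E → EReal} {k : E → ℝ} {Y : Set E} {y : E}
    (hg_bdd : ∃ m : ℝ, ∀ x, (m : EReal) ≤ g x) (hg : LowerSemicontinuous g)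
    (hK0 : ∀ z, 0 ≤ K z) (hK : EConvex K) (hKy : K y = 0) (hY : Y ∈ 𝓝 y)
    (hk : ContinuousOn k Y) (hKk : ∀ z ∈ Y, K z = k z) (hpos : ∀ z ∈ Y, z ≠ y → 0 < k z) :
    Tendsto (fun lam : ℝ => ⨅ z, (g z + ((1 / lam : ℝ) : EReal) * K z)) (𝓝[>] 0)
      (𝓝 (g y)) := by
  obtain ⟨m, hm⟩ := hg_bdd
  refine tendsto_order.2 ⟨fun a ha => ?_, fun a ha => Eventually.of_forall fun lam =>
    (iInf_le _ y).trans_lt (by simpa [hKy] using ha)⟩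
  obtain ⟨b, hab, hb⟩ := EReal.lt_iff_exists_real_btwn.1 ha
  obtain ⟨r, hr, hball⟩ := Metric.eventually_nhds_iff.1 (hg y b hb)
  obtain ⟨δ, hδ, hfar⟩ := exists_pos_le_of_dist hK hKy hY hk hKk hpos hr
  have hε : 0 < δ / (|b - m| + 1) := by positivity
  filter_upwards [Ioo_mem_nhdsGT hε] with lam hlam
  have hc : (0 : EReal) ≤ ((1 / lam : ℝ) : EReal) := by
    exact_mod_cast (one_div_pos.2 hlam.1).le
  refine hab.trans_le (le_iInf fun z => ?_)
  rcases lt_or_ge (dist z y) r with hz | hz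
  · simpa using add_le_add (hball hz).le (mul_nonneg hc (hK0 z))
  · have h1 := add_le_add (hm z) (mul_le_mul_of_nonneg_left (hfar z (by rwa [← dist_eq_norm])) hc)
    refine le_trans ?_ h1
    rw [← EReal.coe_mul, ← EReal.coe_add, EReal.coe_le_coe_iff]
    have h2 := (lt_div_iff₀ (by positivity)).1 hlam.2
    have h3 : b - m ≤ 1 / lam * δ := by
      rw [one_div, ← div_eq_inv_mul, le_div_iff₀ hlam.1]
      nlinarith [le_abs_self (b - m), hlam.1]
    linarith

/-! ### Lipschitz gradient of the right envelope -/

theorem lipschitz_grad_rightEnv (hg : IsGammaZero g) (hψ : IsGammaZero ψ)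
    (hs : EssentiallySmooth ψ) (huniv : intDom ψ = univ) {L : ℝ≥0}
    (hL : LipschitzOnWith L (grad ψ) (intDom ψ))
    (hD : EConvex fun p : E × E => bregman ψ p.1 p.2) {lam : ℝ} (hlam : 0 < lam)
    (hmin : ∀ y ∈ intDom ψ, ∃ p ∈ intDom ψ, g p ≠ ⊤ ∧
      (∀ q, rightObj lam g ψ y p ≤ rightObj lam g ψ y q) ∧
      HasGradientAt (finPart (rightEnv lam g ψ)) ((1 / lam) • (grad ψ y - grad ψ p)) y) :
    LipschitzWith (4 * (L / lam.toNNReal)) (grad (rightEnv lam g ψ)) := by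
  have hY : ∀ z, z ∈ intDom ψ := fun z => huniv ▸ mem_univ z
  have hval : ∀ y, ∃ p ∈ intDom ψ, g p ≠ ⊤ ∧ HasGradientAt (finPart (rightEnv lam g ψ))
      ((1 / lam) • (grad ψ y - grad ψ p)) y ∧
      finPart (rightEnv lam g ψ) y = (g p).toReal + (1 / lam) * bregmanReal ψ y p ∧
      ∀ x, finPart (rightEnv lam g ψ) x ≤ (g p).toReal + (1 / lam) * bregmanReal ψ x p := by
    have hfin : ∀ y, ((finPart (rightEnv lam g ψ) y : ℝ) : EReal) = rightEnv lam g ψ y := by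
      intro y
      obtain ⟨p, hp, hgp, hpm, -⟩ := hmin y (hY y)
      rw [finPart, rightEnv, le_antisymm (iInf_le _ p) (le_iInf hpm),
        rightObj_eq_coe hg hψ (hY y) hp hgp, EReal.toReal_coe]
    intro y
    obtain ⟨p, hp, hgp, hpm, hgr⟩ := hmin y (hY y)
    refine ⟨p, hp, hgp, hgr, ?_, fun x => ?_⟩
    · rw [← EReal.coe_eq_coe_iff, hfin, ← rightObj_eq_coe hg hψ (hY y) hp hgp]
      exact le_antisymm (iInf_le _ p) (le_iInf hpm)
    · rw [← EReal.coe_le_coe_iff, hfin, ← rightObj_eq_coe hg hψ (hY x) hp hgp]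
      exact iInf_le _ p
  have hG : ∀ y, HasGradientAt (finPart (rightEnv lam g ψ)) (grad (rightEnv lam g ψ) y) y := by
    intro y
    obtain ⟨p, -, -, h, -⟩ := hval y
    exact h.differentiableAt.hasGradientAt
  have hconv : ConvexOn ℝ univ (finPart (rightEnv lam g ψ)) := by
    refine (eConvex_rightObj hg hψ hs hD hlam).convexOn_iInf convex_univ fun y _ => ?_
    obtain ⟨p, hp, hgp, hpm, -⟩ := hmin y (hY y)
    refine ⟨p, hpm, ?_, ?_⟩ <;> simp only [rightObj_eq_coe hg hψ (hY y) hp hgp]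
    · exact EReal.coe_ne_bot _
    · exact EReal.coe_ne_top _
  refine LipschitzWith.of_dist_le_mul fun x y => ?_
  rw [dist_eq_norm, dist_eq_norm]
  have hcoe : ((4 * (L / lam.toNNReal) : ℝ≥0) : ℝ) = 4 * ((L : ℝ) / lam) := by
    push_cast [Real.coe_toNNReal lam hlam.le]; rfl
  rw [hcoe]
  refine norm_grad_sub_le hconv hG (fun x y => ?_) x y
  obtain ⟨p, hp, hgp, hgr, hy, hx⟩ := hval y
  rw [(hG y).unique hgr, hy]
  refine (hx x).trans ?_
  -- `D(x, p) - D(y, p) - ⟨∇ψ(y) - ∇ψ(p), x - y⟩ = D(x, y) ≤ ⟨∇ψ(x) - ∇ψ(y), x - y⟩`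
  have h1 := add_inner_grad_le hψ hs (intDom_subset_dom (hY y)) (hY x)
  have h2 : inner ℝ (grad ψ x - grad ψ y) (x - y) ≤ L * ‖x - y‖ ^ 2 := by
    refine (real_inner_le_norm _ _).trans ?_
    rw [pow_two, ← mul_assoc]
    exact mul_le_mul_of_nonneg_right (hL.norm_sub_le (hY x) (hY y)) (norm_nonneg _)
  rw [inner_sub_left] at h2
  rw [← neg_sub x y, inner_neg_right] at h1
  have h3 : bregmanReal ψ x p ≤ bregmanReal ψ y p + inner ℝ (grad ψ y - grad ψ p) (x - y) +
      L * ‖x - y‖ ^ 2 := by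
    rw [bregmanReal, bregmanReal, inner_sub_left,
      show x - p = (x - y) + (y - p) by abel, inner_add_right]
    linarith
  have h4 := mul_le_mul_of_nonneg_left h3 (one_div_pos.2 hlam).le
  rw [real_inner_smul_left]
  have e : (L : ℝ) / lam = 1 / lam * L := by ring
  rw [e]
  linarith

end Envelope

end BregmanMoreau

theorem proposition2 {d : ℕ} (g ψ : EuclideanSpace ℝ (Fin d) → EReal)
    -- assumptions on `g`
    (hg : IsGammaZero g)
    (hg_bdd : ∃ m : ℝ, ∀ x, (m : EReal) ≤ g x)
    (hg_or : ExpNegIntegrable g ∨ IsLipschitz g)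
    -- assumptions on `ψ`
    (hψ : IsGammaZero ψ)
    (hψ_leg : IsLegendre ψ)
    (hψ_smooth : ContDiffOn ℝ 3 (finPart ψ) (intDom ψ))
    (hψ_super : Supercoercive ψ)
    (h_dom : (dom g ∩ intDom ψ).Nonempty)
    -- assumptions on the Bregman divergence of `ψ`
    (hD_joint : EConvex (fun p : EuclideanSpace ℝ (Fin d) × EuclideanSpace ℝ (Fin d) =>
      bregman ψ p.1 p.2))
    (hD_strict : ∀ y ∈ intDom ψ, StrictConvexOn ℝ (intDom ψ) (finPart (bregman ψ y)))
    (hD_cont : ∀ y ∈ intDom ψ, ContinuousOn (finPart (bregman ψ y)) (intDom ψ))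
    (hD_coer : ∀ y ∈ intDom ψ, Coercive (bregman ψ y)) :
    -- (a) finiteness, well-posedness of the proximity operators, and the gradient formulas
    (∀ lam : ℝ, 0 < lam → ∀ y ∈ intDom ψ,
      (leftEnv lam g ψ y ≠ ⊥ ∧ leftEnv lam g ψ y ≠ ⊤ ∧
        ∃ p ∈ intDom ψ, leftProx lam g ψ y = {p} ∧
          HasGradientAt (finPart (leftEnv lam g ψ)) ((1 / lam) • hess ψ y (y - p)) y) ∧
      (rightEnv lam g ψ y ≠ ⊥ ∧ rightEnv lam g ψ y ≠ ⊤ ∧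
        ∃ p ∈ intDom ψ, rightProx lam g ψ y = {p} ∧
          HasGradientAt (finPart (rightEnv lam g ψ)) ((1 / lam) • (grad ψ y - grad ψ p)) y)) ∧
    -- (b) Lipschitz continuity of the gradients
    ((∀ y ∈ intDom ψ, ContinuousOn (finPart (bregman ψ y)) (intDom ψ) ∧
        ConvexOn ℝ (intDom ψ) (finPart (bregman ψ y))) →
      (∃ L : ℝ≥0, LipschitzOnWith L (grad ψ) (intDom ψ)) →
      ∀ lam : ℝ, 0 < lam →
        (∃ K : ℝ≥0, LipschitzOnWith K (grad (leftEnv lam g ψ)) (intDom ψ)) ∧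
        (∃ K : ℝ≥0, LipschitzOnWith K (grad (rightEnv lam g ψ)) (intDom ψ))) ∧
    -- (c) the envelopes increase to `g` as `lam` decreases to `0`
    (∀ y ∈ intDom ψ,
      (AntitoneOn (fun lam : ℝ => leftEnv lam g ψ y) (Ioi 0) ∧
        Tendsto (fun lam : ℝ => leftEnv lam g ψ y) (𝓝[>] 0) (𝓝 (g y))) ∧
      (AntitoneOn (fun lam : ℝ => rightEnv lam g ψ y) (Ioi 0) ∧
        Tendsto (fun lam : ℝ => rightEnv lam g ψ y) (𝓝[>] 0) (𝓝 (g y)))) := by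
  have hs := hψ_leg.essentiallySmooth
  have hleft : ∀ lam : ℝ, 0 < lam → ∀ y ∈ intDom ψ, _ := fun lam hlam y hy =>
    exists_leftProx hg hg_bdd hψ hψ_leg hψ_super h_dom hlam hy
  have hright : ∀ lam : ℝ, 0 < lam → ∀ y ∈ intDom ψ, _ := fun lam hlam y hy =>
    exists_rightProx hg hg_bdd hψ hs h_dom hlam hy (hD_strict y hy) (hD_cont y hy) (hD_coer y hy)
  have hgradR : ∀ {lam : ℝ}, 0 < lam → ∀ {y p}, y ∈ intDom ψ → p ∈ intDom ψ → g p ≠ ⊤ →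
      (∀ q, rightObj lam g ψ y p ≤ rightObj lam g ψ y q) →
      HasGradientAt (finPart (rightEnv lam g ψ)) ((1 / lam) • (grad ψ y - grad ψ p)) y := by
    intro lam hlam y p hy hpY hgp hp
    exact hasGradientAt_rightEnv hg hψ hs hψ_smooth hD_joint hlam
      (exists_rightObj_minimizer hg hg_bdd hψ hs h_dom hD_strict hD_cont hD_coer hlam)
      hy hpY hgp hp
  refine ⟨fun lam hlam y hy => ⟨?_, ?_⟩, fun _ ⟨L, hL⟩ lam hlam => ?_,
    fun y hy => ⟨⟨?_, ?_⟩, ?_, ?_⟩⟩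
  · obtain ⟨p, hpY, hprox, hgp, hp, hpb, hpt⟩ := hleft lam hlam y hy
    have hval : leftEnv lam g ψ y = leftObj lam g ψ y p := le_antisymm (iInf_le _ p) (le_iInf hp)
    exact ⟨hval ▸ hpb, hval ▸ hpt, p, hpY, hprox, hasGradientAt_leftEnv hg hg_bdd hψ hψ_leg
      hψ_smooth hψ_super h_dom hD_joint hlam hy hpY hgp hp⟩
  · obtain ⟨p, hpY, hprox, hgp, hp, hpb, hpt⟩ := hright lam hlam y hy
    have hval : rightEnv lam g ψ y = rightObj lam g ψ y p :=
      le_antisymm (iInf_le _ p) (le_iInf hp)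
    exact ⟨hval ▸ hpb, hval ▸ hpt, p, hpY, hprox, hgradR hlam hy hpY hgp hp⟩
  · -- the Lipschitz gradient makes `D_ψ` symmetric, so that the two envelopes coincide
    have huniv := intDom_eq_univ hs hL
    have hcomm : leftEnv lam g ψ = rightEnv lam g ψ := by
      funext x
      simp only [leftEnv, rightEnv, leftObj, rightObj,
        fun z => bregman_comm hψ hs hψ_smooth hD_joint huniv z x]
    have hlip := lipschitz_grad_rightEnv hg hψ hs huniv hL hD_joint hlam fun y hy => by
      obtain ⟨p, hpY, -, hgp, hp, -, -⟩ := hright lam hlam y hy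
      exact ⟨p, hpY, hgp, hp, hgradR hlam hy hpY hgp hp⟩
    rw [hcomm]
    exact ⟨⟨_, hlip.lipschitzOnWith⟩, ⟨_, hlip.lipschitzOnWith⟩⟩
  · exact antitoneOn_iInf_add_mul fun z => bregman_nonneg hψ hs z y
  · exact tendsto_iInf_add_mul hg_bdd hg.lsc (fun z => bregman_nonneg hψ hs z y)
      (hD_joint.slice_left y)
      (by rw [bregman_eq_coe hψ (intDom_subset_dom hy) hy, bregmanReal_self, EReal.coe_zero])
      (intDom_mem_nhds hy)
      (fun z hz => (continuousAt_bregmanReal_left hs hz).continuousWithinAt)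
      (fun z hz => bregman_eq_coe hψ (intDom_subset_dom hz) hy)
      fun z hz hzy => bregmanReal_pos hψ hψ_leg hz hy hzy
  · exact antitoneOn_iInf_add_mul fun z => bregman_nonneg hψ hs y z
  · refine tendsto_iInf_add_mul hg_bdd hg.lsc (fun z => bregman_nonneg hψ hs y z)
      (EConvex.slice_left
        (hD_joint.comp_linearMap (LinearEquiv.prodComm ℝ _ _).toLinearMap) y)
      (by rw [bregman_eq_coe hψ (intDom_subset_dom hy) hy, bregmanReal_self, EReal.coe_zero])
      (intDom_mem_nhds hy) (hD_cont y hy) (fun z hz => ?_) fun z hz hzy => ?_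
    · rw [finPart_bregman hψ (intDom_subset_dom hy) hz,
        bregman_eq_coe hψ (intDom_subset_dom hy) hz]
    · rw [finPart_bregman hψ (intDom_subset_dom hy) hz]
      exact bregmanReal_pos hψ hψ_leg hy hz hzy.symm
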